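/- Let $E$ be a (real) Banach lattice with topological dual $E'$, ordered by $f\le g$ iff $f(x)\le g(x)$ for all $x\ge 0$ in $E$; a sequence $(f_n)\subset E'$ is called disjoint if $|f_n|\wedge|f_m|=0$ for all $n\neq m$. A bounded set $A\subset E$ is called almost limited if $\sup_{x\in A}|f_n(x)|\to 0$ for every disjoint weak* null sequence $(f_n)\subset E'$. A bounded linear operator $T$ from $E$ into a Banach lattice $F$ is called completely continuous if $\|Tx_n\|\to 0$ for every weakly null sequence $(x_n)\subset E$, and almost limited completely continuous (alcc) if $\|Tx_n\|\to 0$ for every weakly null sequence $(x_n)\subset E$ whose set of terms $\{x_n\}$ is almost limited; every completely continuous operator is alcc. Proposition. Suppose that $E$ has property (d), that is, $|f_n|\to 0$ weak* for every disjoint weak* null sequence $(f_n)\subset E'$. Suppose also that for every Banach lattice $F$ the completely continuous operators $E\to F$ and the alcc operators $E\to F$ coincide, i.e. every alcc operator from $E$ into any Banach lattice is completely continuous. Then $E$ has the weak Dunford–Pettis* property: every relatively weakly compact subset of $E$ is almost limited. -/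

import Mathlib

open Filter Topology

universe u v

set_option linter.unusedSectionVars false

namespace BanachLattice

/-! ### The dual of a Banach lattice as a lattice

`StrongDual ℝ E` gets its usual order: `f ≤ g` iff `f x ≤ g x` for all `x ≥ 0`.  The positive part
of `f` is given by the Riesz-Kantorovich formula `f⁺ x = sup {f y | 0 ≤ y ≤ x}` for `x ≥ 0`. -/

section Dual

variable {E : Type u} [NormedAddCommGroup E] [NormedSpace ℝ E] [Lattice E] [IsOrderedAddMonoid E]
  [IsOrderedModule ℝ E] [HasSolidNorm E]

/-- The Riesz-Kantorovich expression `sup {f y | 0 ≤ y ≤ x}`, meant for `0 ≤ x`. -/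
noncomputable def rk (f : StrongDual ℝ E) (x : E) : ℝ := sSup (f '' Set.Icc 0 x)

theorem rk_upper (f : StrongDual ℝ E) {x z : E} (hz : z ∈ Set.Icc 0 x) : f z ≤ ‖f‖ * ‖x‖ := by
  have h1 : ‖z‖ ≤ ‖x‖ := norm_le_norm_of_abs_le_abs
    (by rw [abs_of_nonneg hz.1, abs_of_nonneg (hz.1.trans hz.2)]; exact hz.2)
  calc f z ≤ ‖f z‖ := Real.le_norm_self _
    _ ≤ ‖f‖ * ‖z‖ := f.le_opNorm z
    _ ≤ ‖f‖ * ‖x‖ := by gcongr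

theorem rk_bddAbove (f : StrongDual ℝ E) (x : E) : BddAbove (f '' Set.Icc 0 x) := by
  refine ⟨‖f‖ * ‖x‖, ?_⟩
  rintro _ ⟨z, hz, rfl⟩
  exact rk_upper f hz

theorem le_rk (f : StrongDual ℝ E) {x z : E} (h0 : 0 ≤ z) (h : z ≤ x) : f z ≤ rk f x :=
  le_csSup (rk_bddAbove f x) ⟨z, ⟨h0, h⟩, rfl⟩

theorem rk_le (f : StrongDual ℝ E) {x : E} (hx : 0 ≤ x) {c : ℝ}
    (h : ∀ z, 0 ≤ z → z ≤ x → f z ≤ c) : rk f x ≤ c := by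
  refine csSup_le ⟨_, 0, ⟨le_rfl, hx⟩, rfl⟩ ?_
  rintro _ ⟨z, hz, rfl⟩
  exact h z hz.1 hz.2

theorem rk_nonneg (f : StrongDual ℝ E) {x : E} (hx : 0 ≤ x) : 0 ≤ rk f x := by
  simpa using le_rk f le_rfl hx

theorem rk_add (f : StrongDual ℝ E) {x y : E} (hx : 0 ≤ x) (hy : 0 ≤ y) :
    rk f (x + y) = rk f x + rk f y := by
  apply le_antisymm
  · refine rk_le f (add_nonneg hx hy) fun z h0 hz => ?_
    have h1 : f (z ⊓ x) ≤ rk f x := le_rk f (le_inf h0 hx) inf_le_right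
    have h2 : f (z - z ⊓ x) ≤ rk f y := by
      refine le_rk f (sub_nonneg.2 inf_le_left) ?_
      rw [sub_le_comm]
      exact le_inf (sub_le_self _ hy) (sub_le_iff_le_add.2 hz)
    rw [map_sub] at h2
    linarith
  · have h : ∀ w, 0 ≤ w → w ≤ y → f w ≤ rk f (x + y) - rk f x := fun w hw hwy => by
      have : rk f x ≤ rk f (x + y) - f w := rk_le f hx fun z hz hzx => by
        have := le_rk f (add_nonneg hz hw) (add_le_add hzx hwy)
        rw [map_add] at this
        linarith
      linarith
    linarith [rk_le f hy h]

theorem rk_sub_eq (f : StrongDual ℝ E) {a b c d : E} (ha : 0 ≤ a) (hb : 0 ≤ b) (hc : 0 ≤ c)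
    (hd : 0 ≤ d) (h : a - b = c - d) : rk f a - rk f b = rk f c - rk f d := by
  have h' : a + d = c + b := sub_eq_sub_iff_add_eq_add.1 h
  have := congrArg (rk f) h'
  rw [rk_add f ha hd, rk_add f hc hb] at this
  linarith

/-- The positive part of a functional: `x ↦ rk f x⁺ - rk f x⁻`. -/
noncomputable def dualPos (f : StrongDual ℝ E) : StrongDual ℝ E :=
  AddMonoidHom.toRealLinearMap
    (AddMonoidHom.mk' (fun x : E => rk f x⁺ - rk f x⁻) fun x y => by
      have hp := posPart_nonneg (x + y)
      have hn := negPart_nonneg (x + y)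
      rw [rk_sub_eq f hp hn (add_nonneg (posPart_nonneg x) (posPart_nonneg y))
        (add_nonneg (negPart_nonneg x) (negPart_nonneg y)) (by
          rw [add_sub_add_comm, posPart_sub_negPart, posPart_sub_negPart, posPart_sub_negPart]),
        rk_add f (posPart_nonneg x) (posPart_nonneg y),
        rk_add f (negPart_nonneg x) (negPart_nonneg y)]
      ring)
    (by
      refine AddMonoidHomClass.continuous_of_bound _ (‖f‖) fun x => ?_
      have hb : ∀ z : E, 0 ≤ z → z ≤ |x| → rk f z ≤ ‖f‖ * ‖x‖ := fun z hz hzx =>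
        rk_le f hz fun w hw hwz => by
          simpa [norm_abs_eq_norm] using rk_upper f ⟨hw, hwz.trans hzx⟩
      have h1 := hb x⁺ (posPart_nonneg x) (sup_le (le_abs_self x) (abs_nonneg x))
      have h2 := hb x⁻ (negPart_nonneg x) (sup_le (neg_le_abs x) (abs_nonneg x))
      have h3 := rk_nonneg f (posPart_nonneg x)
      have h4 := rk_nonneg f (negPart_nonneg x)
      rw [Real.norm_eq_abs, abs_le]
      change -(‖f‖ * ‖x‖) ≤ rk f x⁺ - rk f x⁻ ∧ rk f x⁺ - rk f x⁻ ≤ ‖f‖ * ‖x‖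
      constructor <;> linarith)

theorem dualPos_apply (f : StrongDual ℝ E) {x : E} (hx : 0 ≤ x) : dualPos f x = rk f x := by
  change rk f x⁺ - rk f x⁻ = rk f x
  have h0 : rk f (0 : E) = 0 := by simp [rk]
  rw [posPart_eq_self.2 hx, negPart_eq_zero.2 hx, h0, sub_zero]

/-- The dual order: `f ≤ g` iff `f x ≤ g x` for all `x ≥ 0`. -/
instance dualPartialOrder : PartialOrder (StrongDual ℝ E) where
  le f g := ∀ x : E, 0 ≤ x → f x ≤ g x
  le_refl f x _ := le_rfl
  le_trans f g h hfg hgh x hx := (hfg x hx).trans (hgh x hx)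
  le_antisymm f g hfg hgf := by
    have key : ∀ x : E, 0 ≤ x → f x = g x := fun x hx => le_antisymm (hfg x hx) (hgf x hx)
    ext x
    rw [← posPart_sub_negPart x, map_sub, map_sub, key _ (posPart_nonneg x),
      key _ (negPart_nonneg x)]

theorem dual_le_def {f g : StrongDual ℝ E} : f ≤ g ↔ ∀ x : E, 0 ≤ x → f x ≤ g x := Iff.rfl

instance dualIsOrderedAddMonoid : IsOrderedAddMonoid (StrongDual ℝ E) where
  add_le_add_left f g h k x hx := by simpa using h x hx

theorem le_dualPos (f : StrongDual ℝ E) : f ≤ dualPos f := fun x hx => by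
  rw [dualPos_apply f hx]; exact le_rk f hx le_rfl

theorem dualPos_nonneg (f : StrongDual ℝ E) : 0 ≤ dualPos f := fun x hx => by
  rw [dualPos_apply f hx]; exact rk_nonneg f hx

theorem dualPos_le {f g : StrongDual ℝ E} (hfg : f ≤ g) (hg : 0 ≤ g) : dualPos f ≤ g :=
  fun x hx => by
    rw [dualPos_apply f hx]
    refine rk_le f hx fun z hz hzx => (hfg z hz).trans ?_
    have := hg (x - z) (sub_nonneg.2 hzx)
    rw [map_sub] at this
    simpa using this

/-- The dual is a lattice; `f ⊔ g = g + (f - g)⁺` and `f ⊓ g = f - (f - g)⁺`. -/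
noncomputable instance dualLattice : Lattice (StrongDual ℝ E) where
  sup f g := g + dualPos (f - g)
  le_sup_left f g := by
    have := le_dualPos (f - g)
    rwa [sub_le_iff_le_add'] at this
  le_sup_right f g := le_add_of_nonneg_right (dualPos_nonneg _)
  sup_le f g h hf hg := by
    have := dualPos_le (f := f - g) (g := h - g) (sub_le_sub_right hf g) (sub_nonneg.2 hg)
    rwa [le_sub_iff_add_le'] at this
  inf f g := f - dualPos (f - g)
  inf_le_left f g := sub_le_self _ (dualPos_nonneg _)
  inf_le_right f g := sub_le_comm.1 (le_dualPos _)
  le_inf h f g hf hg := by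
    have := dualPos_le (f := f - g) (g := f - h) (sub_le_sub_left hg f) (sub_nonneg.2 hf)
    exact le_sub_comm.1 this

end Dual

/-! ### Weak and weak* null sequences, property (d), almost limited sets -/

/-- `x n → 0` in the weak topology of `X`. -/
def IsWeaklyNull {X : Type u} [NormedAddCommGroup X] [NormedSpace ℝ X] (x : ℕ → X) : Prop :=
  Tendsto (fun n => toWeakSpace ℝ X (x n)) atTop (𝓝 0)

/-- `f n → 0` in the weak* topology of the dual of `X`. -/
def IsWeakStarNull {X : Type u} [NormedAddCommGroup X] [NormedSpace ℝ X]
    (f : ℕ → StrongDual ℝ X) : Prop :=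
  Tendsto (fun n => StrongDual.toWeakDual (f n)) atTop (𝓝 0)

/-- The closure of `A` in the weak topology of `X` is weakly compact. -/
def IsRelativelyWeaklyCompact {X : Type u} [NormedAddCommGroup X] [NormedSpace ℝ X]
    (A : Set X) : Prop :=
  IsCompact (closure (toWeakSpace ℝ X '' A))

/-- A bounded operator is completely continuous if it maps weakly null sequences to norm null
sequences. -/
def IsCompletelyContinuous {X : Type u} {Y : Type v} [NormedAddCommGroup X] [NormedSpace ℝ X]
    [NormedAddCommGroup Y] [NormedSpace ℝ Y] (T : X →L[ℝ] Y) : Prop :=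
  ∀ x : ℕ → X, IsWeaklyNull x → Tendsto (fun n => T (x n)) atTop (𝓝 0)

section

variable {E : Type u} [NormedAddCommGroup E] [NormedSpace ℝ E] [Lattice E] [IsOrderedAddMonoid E]
  [IsOrderedModule ℝ E] [HasSolidNorm E]

/-- A sequence in the dual lattice with pairwise disjoint terms. -/
def IsDisjointSeq (f : ℕ → StrongDual ℝ E) : Prop :=
  ∀ m n, m ≠ n → |f m| ⊓ |f n| = 0

/-- `A` is almost limited: it is bounded, and every disjoint weak* null sequence of functionals
converges to zero uniformly on `A`. -/
def IsAlmostLimited (A : Set E) : Prop :=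
  Bornology.IsBounded A ∧
    ∀ f : ℕ → StrongDual ℝ E, IsDisjointSeq f → IsWeakStarNull f →
      TendstoUniformlyOn (fun n x => f n x) (fun _ => 0) atTop A

/-- `T` is an almost limited completely continuous operator: `T (x n) → 0` for every weakly null
sequence `x` whose set of terms is almost limited. -/
def IsAlcc {Y : Type v} [NormedAddCommGroup Y] [NormedSpace ℝ Y] (T : E →L[ℝ] Y) : Prop :=
  ∀ x : ℕ → E, IsAlmostLimited (Set.range x) → IsWeaklyNull x →
    Tendsto (fun n => T (x n)) atTop (𝓝 0)

variable (E)

/-- Property (d): `|f n| → 0` weak* for every disjoint weak* null sequence in the dual. -/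
def HasPropertyD : Prop :=
  ∀ f : ℕ → StrongDual ℝ E, IsDisjointSeq f → IsWeakStarNull f → IsWeakStarNull fun n => |f n|

/-- The weak Dunford-Pettis* property: relatively weakly compact sets are almost limited. -/
def HasWeakDPStar : Prop :=
  ∀ A : Set E, IsRelativelyWeaklyCompact A → IsAlmostLimited A

end

end BanachLattice

open BoundedContinuousFunction

namespace BanachLattice

section WeakTopology

variable {X : Type u} [NormedAddCommGroup X] [NormedSpace ℝ X]

/-! A disjoint weak* null sequence `f` is norm bounded, so `T x = (f n x)` defines an operator into
the Banach lattice of bounded sequences, and `‖T x‖` controls all the `f n x` at once. Almost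
limited sets are those bounded sets on which every such `f` tends to zero uniformly, which makes `T`
alcc (`isAlcc_seqOperator`); by hypothesis `T` is then completely continuous.

If `f` were not uniformly null on a relatively weakly compact `A`, some points `a k` of `A` would
keep `|f (ψ k) (a k)| ≥ ε`. By Eberlein-Šmulian (`IsRelativelyWeaklyCompact.exists_subseq`) a
subsequence converges weakly to some `b`. Then `T (a k - b) → 0` in norm along it, while `f n b →
0`, a contradiction. -/

theorem continuous_eval_weakSpace (g : StrongDual ℝ X) :
    Continuous fun x : WeakSpace ℝ X => g ((toWeakSpace ℝ X).symm x) :=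
  WeakBilin.eval_continuous (topDualPairing ℝ X).flip g

theorem isWeaklyNull_of_forall {x : ℕ → X}
    (h : ∀ g : StrongDual ℝ X, Tendsto (fun n => g (x n)) atTop (𝓝 0)) : IsWeaklyNull x := by
  refine (NormedSpace.isEmbedding_inclusionInDoubleDualWeak ℝ X).tendsto_nhds_iff.2 ?_
  refine tendsto_iff_forall_eval_tendsto_topDualPairing.2 fun g => ?_
  simpa using! h g

theorem IsWeaklyNull.tendsto_apply {x : ℕ → X} (h : IsWeaklyNull x) (g : StrongDual ℝ X) :
    Tendsto (fun n => g (x n)) atTop (𝓝 0) := by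
  have := ((continuous_eval_weakSpace g).tendsto 0).comp h
  simpa [Function.comp_def] using this

theorem IsWeakStarNull.tendsto_apply {f : ℕ → StrongDual ℝ X} (h : IsWeakStarNull f) (x : X) :
    Tendsto (fun n => f n x) atTop (𝓝 0) := by
  have := ((WeakDual.eval_continuous (𝕜 := ℝ) x).tendsto 0).comp h
  simpa [Function.comp_def] using! this

/-- Each functional is bounded on the weakly compact closure; uniform boundedness applies to `A`
embedded in the bidual. -/
theorem IsRelativelyWeaklyCompact.isBounded {A : Set X} (hA : IsRelativelyWeaklyCompact A) :
    Bornology.IsBounded A := by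
  obtain ⟨C, hC⟩ := banach_steinhaus
    (g := fun a : A => NormedSpace.inclusionInDoubleDual ℝ X (a : X)) (fun g => by
      obtain ⟨C, hC⟩ := (hA.image (continuous_eval_weakSpace g)).isBounded.exists_norm_le
      exact ⟨C, fun a => hC _ ⟨_, subset_closure ⟨a, a.2, rfl⟩, by simp⟩⟩)
  refine isBounded_iff_forall_norm_le.2 ⟨C, fun a ha => ?_⟩
  rw [← (NormedSpace.inclusionInDoubleDualLi (E := X) ℝ).norm_map a]
  exact hC ⟨a, ha⟩

/-- A separable subspace admits a countable family of functionals that separates its points. -/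
theorem exists_seq_dual_separating {Y : Submodule ℝ X}
    (hY : TopologicalSpace.IsSeparable (Y : Set X)) :
    ∃ g : ℕ → StrongDual ℝ X, ∀ y ∈ Y, (∀ n, g n y = 0) → y = 0 := by
  have := hY.separableSpace
  choose g hg1 hg using fun n : ℕ =>
    exists_dual_vector'' ℝ ((TopologicalSpace.denseSeq Y n : Y) : X)
  refine ⟨g, fun y hy h0 => ?_⟩
  by_contra hne
  have hpos : 0 < ‖y‖ / 2 := by positivity
  obtain ⟨n, hn⟩ := (TopologicalSpace.denseRange_denseSeq Y).exists_dist_lt ⟨y, hy⟩ hpos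
  set z : X := Subtype.val (TopologicalSpace.denseSeq Y n)
  have hn' : ‖y - z‖ < ‖y‖ / 2 := by simpa [Subtype.dist_eq, dist_eq_norm] using hn
  -- `g n` norms `z` but kills `y`, so `z` cannot be closer to `y` than its own norm.
  have h1 : ‖z‖ ≤ ‖y - z‖ := by
    calc ‖z‖ = g n z := by simpa using (hg n).symm
      _ = -g n (y - z) := by simp [h0 n]
      _ ≤ ‖g n (y - z)‖ := neg_le_abs _
      _ ≤ 1 * ‖y - z‖ := (g n).le_of_opNorm_le (hg1 n) _
      _ = ‖y - z‖ := one_mul _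
  have h2 : ‖y‖ ≤ ‖y - z‖ + ‖z‖ := by simpa using norm_add_le (y - z) z
  linarith

/-- One half of the Eberlein-Šmulian theorem: a relatively weakly compact set is relatively weakly
sequentially compact. -/
theorem IsRelativelyWeaklyCompact.exists_subseq {A : Set X} (hA : IsRelativelyWeaklyCompact A)
    {a : ℕ → X} (ha : ∀ n, a n ∈ A) :
    ∃ (b : X) (φ : ℕ → ℕ), StrictMono φ ∧ IsWeaklyNull fun n => a (φ n) - b := by
  set Y : Submodule ℝ X := (Submodule.span ℝ (Set.range a)).topologicalClosure
  have hYsep : TopologicalSpace.IsSeparable (Y : Set X) :=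
    ((Set.countable_range a).isSeparable.span (R := ℝ)).closure
  have haY : ∀ n, a n ∈ Y := fun n =>
    Submodule.le_topologicalClosure _ (Submodule.subset_span ⟨n, rfl⟩)
  -- Mazur: a norm closed convex set is weakly closed.
  have hYclosed : IsClosed (toWeakSpace ℝ X '' (Y : Set X)) := by
    have := Y.convex.toWeakSpace_closure ℝ
    rw [(Submodule.isClosed_topologicalClosure _).closure_eq] at this
    rw [this]
    exact isClosed_closure
  obtain ⟨g, hg⟩ := exists_seq_dual_separating hYsep
  let K : Set (WeakSpace ℝ X) := closure (toWeakSpace ℝ X '' A) ∩ toWeakSpace ℝ X '' (Y : Set X)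
  have hK : IsCompact K := hA.inter_right hYclosed
  have : CompactSpace K := isCompact_iff_compactSpace.1 hK
  -- A compact space with countably many continuous real functions separating its points is
  -- metrizable, hence sequentially compact.
  have : TopologicalSpace.MetrizableSpace K :=
    Metric.PiNatEmbed.TopologicalSpace.MetrizableSpace.of_countable_separating
      (fun n x => g n ((toWeakSpace ℝ X).symm (x : WeakSpace ℝ X)))
      (fun n => (continuous_eval_weakSpace (g n)).comp continuous_subtype_val)
      (by
        rintro ⟨_, _, y, hy, rfl⟩ ⟨_, _, z, hz, rfl⟩ hne
        by_contra! h
        have hyz : y - z = 0 := hg _ (Y.sub_mem hy hz) fun n => by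
          simpa [sub_eq_zero] using h n
        obtain rfl := sub_eq_zero.1 hyz
        exact hne rfl)
  let := TopologicalSpace.metrizableSpaceMetric K
  obtain ⟨b, φ, hφ, hb⟩ := CompactSpace.tendsto_subseq fun n : ℕ =>
    (⟨toWeakSpace ℝ X (a n), subset_closure ⟨_, ha n, rfl⟩, ⟨_, haY n, rfl⟩⟩ : K)
  refine ⟨(toWeakSpace ℝ X).symm b, φ, hφ, isWeaklyNull_of_forall fun f => ?_⟩
  have h1 := (((continuous_eval_weakSpace f).comp continuous_subtype_val).tendsto b).comp hb
  simpa [Function.comp_def] using h1.sub_const (f ((toWeakSpace ℝ X).symm b))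

end WeakTopology

section EvaluationOperator

variable {X : Type u} [NormedAddCommGroup X] [NormedSpace ℝ X]

instance isOrderedModule_boundedContinuousFunction {α : Type v} [TopologicalSpace α] :
    IsOrderedModule ℝ (α →ᵇ ℝ) where
  smul_le_smul_of_nonneg_left _ hc _ _ hfg t := mul_le_mul_of_nonneg_left (hfg t) hc
  smul_le_smul_of_nonneg_right _ hf _ _ hcd t := mul_le_mul_of_nonneg_right hcd (hf t)

/-- A sequence of functionals that is bounded in norm, regarded as an operator `x ↦ (f n x)` into
the Banach lattice of bounded sequences. -/
noncomputable def seqOperator (f : ℕ → StrongDual ℝ X) (C : ℝ) (hC : ∀ n, ‖f n‖ ≤ C) :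
    X →L[ℝ] ULift.{v} ℕ →ᵇ ℝ :=
  LinearMap.mkContinuous
    { toFun := fun x => ofNormedAddCommGroupDiscrete (fun n : ULift.{v} ℕ => f n.down x)
        (C * ‖x‖) fun n => (f n.down).le_of_opNorm_le (hC n.down) x
      map_add' := fun x y => by ext; simp
      map_smul' := fun c x => by ext; simp }
    C fun x => (norm_le (mul_nonneg ((norm_nonneg _).trans (hC 0)) (norm_nonneg x))).2 fun n =>
      (f n.down).le_of_opNorm_le (hC n.down) x

@[simp]
theorem seqOperator_apply (f : ℕ → StrongDual ℝ X) (C : ℝ) (hC : ∀ n, ‖f n‖ ≤ C) (x : X)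
    (n : ULift.{v} ℕ) : seqOperator f C hC x n = f n.down x := rfl

theorem IsWeakStarNull.exists_norm_le [CompleteSpace X] {f : ℕ → StrongDual ℝ X}
    (h : IsWeakStarNull f) : ∃ C, ∀ n, ‖f n‖ ≤ C :=
  banach_steinhaus fun x => by
    obtain ⟨C, hC⟩ := (Metric.isBounded_range_of_tendsto _ (h.tendsto_apply x)).exists_norm_le
    exact ⟨C, fun n => hC _ ⟨n, rfl⟩⟩

end EvaluationOperator

variable {E : Type u} [NormedAddCommGroup E] [NormedSpace ℝ E] [Lattice E] [IsOrderedAddMonoid E]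
  [IsOrderedModule ℝ E] [HasSolidNorm E]

/-- Uniform convergence on the terms of `x` makes all coordinates from some `N` on small for every
`k` simultaneously; the finitely many others tend to zero since `x` is weakly null. -/
theorem isAlcc_seqOperator {f : ℕ → StrongDual ℝ E} (hdisj : IsDisjointSeq f)
    (hnull : IsWeakStarNull f) (C : ℝ) (hC : ∀ n, ‖f n‖ ≤ C) :
    IsAlcc (seqOperator.{u, v} f C hC) := by
  intro x hx hx0
  have hunif := Metric.tendstoUniformlyOn_iff.1 (hx.2 f hdisj hnull)
  rw [NormedAddGroup.tendsto_nhds_zero]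
  intro ε hε
  obtain ⟨N, hN⟩ := eventually_atTop.1 (hunif (ε / 2) (half_pos hε))
  have hfin : ∀ᶠ k in atTop, ∀ n ∈ Set.Iio N, ‖f n (x k)‖ < ε / 2 :=
    (eventually_all_finite (Set.finite_Iio N)).2 fun n _ =>
      NormedAddGroup.tendsto_nhds_zero.1 (hx0.tendsto_apply (f n)) (ε / 2) (half_pos hε)
  filter_upwards [hfin] with k hk
  refine lt_of_le_of_lt ((norm_le (half_pos hε).le).2 fun n => ?_) (half_lt_self hε)
  rcases lt_or_ge n.down N with hn | hn
  · exact (hk _ hn).le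
  · simpa using! (hN _ hn (x k) ⟨k, rfl⟩).le

end BanachLattice

open BanachLattice in
theorem mainTheorem11 (E : Type u) [NormedAddCommGroup E] [NormedSpace ℝ E] [CompleteSpace E]
    [Lattice E] [IsOrderedAddMonoid E] [IsOrderedModule ℝ E] [HasSolidNorm E]
    (hd : BanachLattice.HasPropertyD E)
    (hE : ∀ (F : Type v) [NormedAddCommGroup F] [NormedSpace ℝ F] [CompleteSpace F]
      [Lattice F] [IsOrderedAddMonoid F] [IsOrderedModule ℝ F] [HasSolidNorm F] (T : E →L[ℝ] F),
      BanachLattice.IsAlcc T → BanachLattice.IsCompletelyContinuous T) :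
    BanachLattice.HasWeakDPStar E := by
  intro A hA
  refine ⟨hA.isBounded, fun f hdisj hnull => Metric.tendstoUniformlyOn_iff.2 fun ε hε => ?_⟩
  by_contra hnot
  obtain ⟨C, hC⟩ := hnull.exists_norm_le
  obtain ⟨ψ, hψ, hψε⟩ := extraction_of_frequently_atTop (not_eventually.1 hnot)
  push Not at hψε
  choose a haA ha using hψε
  obtain ⟨b, φ, hφ, hb⟩ := hA.exists_subseq haA
  -- The index type `ULift.{v} ℕ` places the sequence space in the universe over which `hE`
  -- quantifies.
  have hT := hE _ _ (isAlcc_seqOperator.{u, v} hdisj hnull C hC) _ hb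
  have h1 : Tendsto (fun k => f (ψ (φ k)) (a (φ k) - b)) atTop (𝓝 0) :=
    -- The coordinate `ψ (φ k)` moves with `k`, so norm convergence of the images is needed here.
    squeeze_zero_norm (fun k => (seqOperator.{u, v} f C hC (a (φ k) - b)).norm_coe_le_norm
      ⟨ψ (φ k)⟩) (by simpa using hT.norm)
  have h2 : Tendsto (fun k => f (ψ (φ k)) b) atTop (𝓝 0) :=
    (hnull.tendsto_apply b).comp (hψ.comp hφ).tendsto_atTop
  have h3 : Tendsto (fun k => f (ψ (φ k)) (a (φ k))) atTop (𝓝 0) := by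
    simpa using h1.add h2
  obtain ⟨k, hk⟩ := (NormedAddGroup.tendsto_nhds_zero.1 h3 ε hε).exists
  have := ha (φ k)
  rw [dist_zero_left] at this
  exact absurd hk (not_lt.2 this)
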